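/- Let $Z_1,Z_2,\dots$ be i.i.d. standard normal random variables, let $B=(B_t)_{t\ge 0}$ be a standard Brownian motion, and let $\kappa\in\mathbb R$. Put $$\rho(\kappa):=\mathbb E\Big[\sup_{0\le t\le 1}\big(B_t-\kappa\sqrt t\big)\Big].$$ Then this expectation is finite, the expectations below are finite for every $N\ge1$, and $$\lim_{N\to\infty}\mathbb E\Big[\max_{n\le N}\frac{\sum_{i=1}^n Z_i-\kappa\sqrt n}{\sqrt N}\Big]=\rho(\kappa),$$ both when the maximum is taken over $0\le n\le N$ and when it is taken over $1\le n\le N$. Consequently, let $\sigma>0$ and $\mu_1,\mu_2,\dots\in\mathbb R$, and consider the lost-sales model in which period $n$ has demand $D_n=\mu_n+\sigma Z_n$ and supply $x_n=\mu_n+\kappa\sigma(\sqrt n-\sqrt{n-1})$. Let $H_n$ be the on-hand inventory and $L_n$ the cumulative lost sales at the end of period $n$, that is, $H_0=L_0=0$, $H_n=\max\{H_{n-1}+x_n-D_n,0\}$ and $L_n=L_{n-1}+\max\{D_n-x_n-H_{n-1},0\}$ (equivalently, $L_n=\max_{0\le j\le n}\sum_{i=1}^{j}(D_i-x_i)$).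 Then $\mathbb E[L_N]$ is finite for every $N$ and $$\lim_{N\to\infty}\frac{\mathbb E[L_N]}{\sigma\sqrt N}=\rho(\kappa).$$ -/

import Mathlib

open MeasureTheory ProbabilityTheory Filter Topology
open scoped NNReal

namespace LostSales

/-- The scaled walk `(∑_{i ≤ n} z_i - κ √n) / √N` of a real sequence, where `z i` (with `i`
counted from `0`) is the term with number `i + 1`, so that the sum has exactly `n` terms. -/
noncomputable def scaledWalk (z : ℕ → ℝ) (κ : ℝ) (N n : ℕ) : ℝ :=
  ((∑ i ∈ Finset.range n, z i) - κ * √(n : ℝ)) / √(N : ℝ)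

/-- `max_{a ≤ n ≤ N}` of the scaled walk (used for `a = 0` and `a = 1`). The index set is finite,
so for `a ≤ N` the supremum is a maximum. -/
noncomputable def scaledMax (a : ℕ) (z : ℕ → ℝ) (κ : ℝ) (N : ℕ) : ℝ :=
  ⨆ n : Set.Icc a N, scaledWalk z κ N n

/-- `sup_{0 ≤ t ≤ 1} (b_t - κ √t)` for a real path `b`. -/
noncomputable def pathSup (b : ℝ≥0 → ℝ) (κ : ℝ) : ℝ :=
  ⨆ t : Set.Icc (0 : ℝ≥0) 1, (b t - κ * √((t : ℝ≥0) : ℝ))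

/-- The Brownian functional `ρ(κ) = E[sup_{0 ≤ t ≤ 1} (B_t - κ √t)]`. -/
noncomputable def rho {Ω : Type*} [MeasurableSpace Ω] (B : ℝ≥0 → Ω → ℝ) (P : Measure Ω)
    (κ : ℝ) : ℝ :=
  ∫ ω, pathSup (fun t => B t ω) κ ∂P

/-- Demand `D = μ + σ Z` in each period. Index `i` stands for period `i + 1`. -/
def demand (μ : ℕ → ℝ) (σ : ℝ) (z : ℕ → ℝ) (i : ℕ) : ℝ :=
  μ i + σ * z i

/-- Supply in period `i + 1`, namely `μ + κ σ (√(i + 1) - √i)`: the cumulative supply up to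
period `n` is the cumulative mean demand plus `κ σ √n` (safety factor `1 / 2`). -/
noncomputable def supply (μ : ℕ → ℝ) (σ κ : ℝ) (i : ℕ) : ℝ :=
  μ i + κ * σ * (√((i : ℝ) + 1) - √(i : ℝ))

/-- Inventory on hand at the end of period `n` in the lost-sales model, with demands `D` and
supplies `x` (index `i` stands for period `i + 1`) and no initial inventory. -/
def onHand (D x : ℕ → ℝ) : ℕ → ℝ
  | 0 => 0
  | n + 1 => max (onHand D x n + x n - D n) 0

/-- Cumulative lost sales up to the end of period `n` in the lost-sales model: in each period the
demand that exceeds the inventory on hand plus the new supply is lost. -/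
def lostSales (D x : ℕ → ℝ) : ℕ → ℝ
  | 0 => 0
  | n + 1 => lostSales D x n + max (D n - (onHand D x n + x n)) 0

/-- Net demand `S_n = ∑_{i ≤ n} (D_i - x_i)`. -/
def netDemand (D x : ℕ → ℝ) (n : ℕ) : ℝ :=
  ∑ i ∈ Finset.range n, (D i - x i)

lemma lostSales_sub_onHand (D x : ℕ → ℝ) (n : ℕ) :
    lostSales D x n - onHand D x n = netDemand D x n := by
  induction n with
  | zero => simp [lostSales, onHand, netDemand]
  | succ n ih =>
    simp only [netDemand, Finset.sum_range_succ, lostSales, onHand] at ih ⊢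
    rcases le_total (onHand D x n + x n - D n) 0 with h | h
    · rw [max_eq_right h, max_eq_left (by linarith)]; linarith
    · rw [max_eq_left h, max_eq_right (by linarith)]; linarith

/-- The cumulative lost sales are the running maximum `L_n = max_{0 ≤ j ≤ n} S_j` of the net
demand. -/
lemma lostSales_eq_max (D x : ℕ → ℝ) (n : ℕ) :
    lostSales D x n =
      (Finset.range (n + 1)).sup' Finset.nonempty_range_add_one (netDemand D x) := by
  induction n with
  | zero => simp [lostSales, netDemand]
  | succ n ih =>
    have h1 := lostSales_sub_onHand D x n
    have h2 : netDemand D x (n + 1) = netDemand D x n + (D n - x n) := by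
      simp only [netDemand, Finset.sum_range_succ]
    have h3 : (Finset.range (n + 1 + 1)).sup' Finset.nonempty_range_add_one (netDemand D x) =
        netDemand D x (n + 1) ⊔
          (Finset.range (n + 1)).sup' Finset.nonempty_range_add_one (netDemand D x) := by
      rw [← Finset.sup'_insert]
      congr 1
      exact Finset.range_add_one
    rw [h3, ← ih, lostSales, h2]
    rcases le_total (D n - (onHand D x n + x n)) 0 with h | h
    · rw [max_eq_right h, sup_eq_right.2 (by linarith)]; linarith
    · rw [max_eq_left h, sup_eq_left.2 (by linarith)]; linarith

end LostSales

namespace LostSales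

/-- The running maximum `max_{0 ≤ n ≤ N} ∑_{i < n} z i` of the partial sums of a sequence. -/
noncomputable def runMax (z : ℕ → ℝ) : ℕ → ℝ
  | 0 => 0
  | n + 1 => max (runMax z n) (∑ i ∈ Finset.range (n + 1), z i)

lemma sum_le_runMax (z : ℕ → ℝ) {n N : ℕ} (h : n ≤ N) :
    ∑ i ∈ Finset.range n, z i ≤ runMax z N := by
  induction N with
  | zero => obtain rfl : n = 0 := by omega
            simp [runMax]
  | succ N ih =>
    rcases Nat.le_succ_iff.1 h with h | rfl
    · exact (ih h).trans (le_max_left _ _)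
    · exact le_max_right _ _

lemma runMax_congr {z w : ℕ → ℝ} {N : ℕ} (h : ∀ i < N, z i = w i) : runMax z N = runMax w N := by
  induction N with
  | zero => rfl
  | succ N ih =>
    rw [runMax, runMax, ih fun i hi => h i (by omega),
      Finset.sum_congr rfl fun i hi => h i (Finset.mem_range.1 hi)]

lemma measurable_runMax (N : ℕ) : Measurable fun z : ℕ → ℝ => runMax z N := by
  induction N with
  | zero => exact measurable_const
  | succ N ih => exact ih.max (by fun_prop)

/-- Pathwise form of Doob's `L²` inequality. -/
lemma runMax_sq_le (z : ℕ → ℝ) (N : ℕ) :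
    runMax z N ^ 2 ≤ 4 * (∑ i ∈ Finset.range N, z i) ^ 2
      - 4 * ∑ k ∈ Finset.range N, runMax z k * z k := by
  have key : 2 * ∑ k ∈ Finset.range N, runMax z k * z k ≤
      2 * runMax z N * (∑ i ∈ Finset.range N, z i) - runMax z N ^ 2 := by
    induction N with
    | zero => simp [runMax]
    | succ N ih =>
      rw [runMax, Finset.sum_range_succ, Finset.sum_range_succ]
      rcases le_total (runMax z N) (∑ i ∈ Finset.range N, z i + z N) with h | h
      · rw [max_eq_right h]
        nlinarith [sq_nonneg (∑ i ∈ Finset.range N, z i + z N - runMax z N)]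
      · rw [max_eq_left h]
        nlinarith
  nlinarith [sq_nonneg (runMax z N - 2 * ∑ i ∈ Finset.range N, z i)]

section Doob

variable {Ω : Type*} [MeasurableSpace Ω] {P : Measure Ω} {D : ℕ → Ω → ℝ}

lemma memLp_runMax (hD : ∀ i, MemLp (D i) 2 P) (N : ℕ) :
    MemLp (fun ω => runMax (fun i => D i ω) N) 2 P := by
  induction N with
  | zero => exact MemLp.zero
  | succ N ih => exact ih.sup (memLp_finsetSum _ fun i _ => hD i)

lemma indepFun_runMax (hD : ∀ i, AEMeasurable (D i) P) (hind : iIndepFun D P) (k : ℕ) :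
    IndepFun (fun ω => runMax (fun i => D i ω) k) (D k) P := by
  have h := hind.indepFun_finset₀ (Finset.range k) {k} (by simp) hD
  let φ : (Finset.range k → ℝ) → ℝ := fun y =>
    runMax (fun i => if hi : i ∈ Finset.range k then y ⟨i, hi⟩ else 0) k
  let ψ : (({k} : Finset ℕ) → ℝ) → ℝ := fun y => y ⟨k, by simp⟩
  have hφ : Measurable φ := by
    refine (measurable_runMax k).comp (measurable_pi_lambda _ fun i => ?_)
    split_ifs with hi
    · fun_prop
    · fun_prop
  have hψ : Measurable ψ := by fun_prop
  convert h.comp hφ hψ using 1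
  · ext ω
    exact runMax_congr fun i hi => by simp [hi]
  · rfl

/-- Doob's `L²` inequality for a walk with independent centered increments. -/
lemma integral_runMax_sq_le (hD : ∀ i, MemLp (D i) 2 P) (hind : iIndepFun D P)
    (h0 : ∀ i, ∫ ω, D i ω ∂P = 0) (N : ℕ) :
    ∫ ω, runMax (fun i => D i ω) N ^ 2 ∂P ≤
      4 * ∫ ω, (∑ i ∈ Finset.range N, D i ω) ^ 2 ∂P := by
  have hS : MemLp (fun ω => ∑ i ∈ Finset.range N, D i ω) 2 P :=
    memLp_finsetSum _ fun i _ => hD i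
  have hint (k : ℕ) : Integrable (fun ω => runMax (fun i => D i ω) k * D k ω) P :=
    (memLp_runMax hD k).integrable_mul (hD k)
  have hz (k : ℕ) : ∫ ω, runMax (fun i => D i ω) k * D k ω ∂P = 0 := by
    rw [(indepFun_runMax (fun i => (hD i).aemeasurable) hind k).integral_fun_mul_eq_mul_integral
      (memLp_runMax hD k).aestronglyMeasurable (hD k).aestronglyMeasurable, h0, mul_zero]
  calc ∫ ω, runMax (fun i => D i ω) N ^ 2 ∂P
      ≤ ∫ ω, (4 * (∑ i ∈ Finset.range N, D i ω) ^ 2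
          - 4 * ∑ k ∈ Finset.range N, runMax (fun i => D i ω) k * D k ω) ∂P :=
        integral_mono (memLp_runMax hD N).integrable_sq
          ((hS.integrable_sq.const_mul 4).sub
            ((integrable_finsetSum _ fun k _ => hint k).const_mul 4))
          fun ω => runMax_sq_le _ N
    _ = 4 * ∫ ω, (∑ i ∈ Finset.range N, D i ω) ^ 2 ∂P := by
        rw [integral_sub (hS.integrable_sq.const_mul 4)
            ((integrable_finsetSum _ fun k _ => hint k).const_mul 4),
          integral_const_mul, integral_const_mul, integral_finsetSum _ fun k _ => hint k]
        simp [hz]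

end Doob

section Grid

variable {f : ℝ≥0 → ℝ}

lemma bddAbove_range_Icc (hf : Continuous f) :
    BddAbove (Set.range fun t : Set.Icc (0 : ℝ≥0) 1 => f t) := by
  have h := (isCompact_Icc (a := (0 : ℝ≥0)) (b := 1)).bddAbove_image hf.continuousOn
  rwa [Set.image_eq_range] at h

lemma natCast_div_mem_Icc {n N : ℕ} (h : n ≤ N) : (n : ℝ≥0) / N ∈ Set.Icc (0 : ℝ≥0) 1 :=
  ⟨zero_le, div_le_one_of_le₀ (by exact_mod_cast h) zero_le⟩

/-- The maximum of a continuous function over the grid `n / N`, `a ≤ n ≤ N`, converges to its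
supremum over `[0, 1]`. -/
lemma tendsto_iSup_grid (hf : Continuous f) (a : ℕ) :
    Tendsto (fun N : ℕ => ⨆ n : Set.Icc a N, f ((n : ℕ) / (N : ℝ≥0))) atTop
      (𝓝 (⨆ t : Set.Icc (0 : ℝ≥0) 1, f t)) := by
  obtain ⟨t₀, ht₀, hmax⟩ := (isCompact_Icc (a := (0 : ℝ≥0)) (b := 1)).exists_isMaxOn
    ⟨0, by simp⟩ hf.continuousOn
  have : Nonempty (Set.Icc (0 : ℝ≥0) 1) := ⟨⟨t₀, ht₀⟩⟩
  have hsup : (⨆ t : Set.Icc (0 : ℝ≥0) 1, f t) = f t₀ :=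
    le_antisymm (ciSup_le fun t => hmax t.2) (le_ciSup (bddAbove_range_Icc hf) ⟨t₀, ht₀⟩)
  let m : ℕ → ℕ := fun N => max a ⌊(t₀ : ℝ) * N⌋₊
  have hm : Tendsto (fun N : ℕ => (m N : ℝ≥0) / N) atTop (𝓝 t₀) := by
    have h1 : Tendsto (fun N : ℕ => (a : ℝ) / N) atTop (𝓝 0) :=
      tendsto_const_div_atTop_nhds_zero_nat _
    have h2 : Tendsto (fun N : ℕ => (⌊(t₀ : ℝ) * N⌋₊ : ℝ) / N) atTop (𝓝 t₀) :=
      (tendsto_nat_floor_mul_div_atTop t₀.coe_nonneg).comp tendsto_natCast_atTop_atTop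
    have h3 := h1.max h2
    rw [max_eq_right t₀.coe_nonneg] at h3
    refine NNReal.tendsto_coe.1 (h3.congr fun N => ?_)
    simp only [m, NNReal.coe_div, NNReal.coe_natCast, Nat.cast_max]
    exact max_div_div_right (Nat.cast_nonneg N) _ _
  rw [hsup]
  refine tendsto_of_tendsto_of_tendsto_of_le_of_le' ((hf.tendsto t₀).comp hm)
    tendsto_const_nhds ?_ ?_
  · filter_upwards [eventually_ge_atTop a] with N hN
    have hmN : m N ∈ Set.Icc a N := by
      refine ⟨le_max_left _ _, max_le hN (Nat.floor_le_of_le ?_)⟩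
      exact mul_le_of_le_one_left (Nat.cast_nonneg N) (by exact_mod_cast ht₀.2)
    exact le_ciSup (f := fun n : Set.Icc a N => f ((n : ℕ) / (N : ℝ≥0)))
      (Set.finite_range _).bddAbove ⟨m N, hmN⟩
  · filter_upwards [eventually_ge_atTop a] with N hN
    have : Nonempty (Set.Icc a N) := ⟨⟨a, le_rfl, hN⟩⟩
    exact ciSup_le fun n => hmax (natCast_div_mem_Icc n.2.2)

lemma abs_iSup_le {ι : Sort*} {g : ι → ℝ} {C : ℝ} (hC : 0 ≤ C) (h : ∀ i, |g i| ≤ C) :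
    |⨆ i, g i| ≤ C := by
  rcases isEmpty_or_nonempty ι with hι | ⟨⟨i⟩⟩
  · simpa using hC
  · have : Nonempty ι := ⟨i⟩
    refine abs_le.2 ⟨(abs_le.1 (h i)).1.trans (le_ciSup ⟨C, ?_⟩ i), ciSup_le fun i => (abs_le.1 (h i)).2⟩
    rintro _ ⟨j, rfl⟩
    exact (abs_le.1 (h j)).2

lemma integrable_iSup {Ω ι : Type*} [MeasurableSpace Ω] {P : Measure Ω} [Finite ι]
    {g : ι → Ω → ℝ} (hg : ∀ i, Integrable (g i) P) : Integrable (fun ω => ⨆ i, g i ω) P := by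
  cases nonempty_fintype ι
  refine (integrable_finsetSum Finset.univ fun i _ => (hg i).abs).mono'
    (AEMeasurable.iSup fun i => (hg i).aemeasurable).aestronglyMeasurable (.of_forall fun ω => ?_)
  refine abs_iSup_le (Finset.sum_nonneg fun i _ => abs_nonneg _) fun i => ?_
  exact Finset.single_le_sum (f := fun i => |g i ω|) (fun i _ => abs_nonneg _) (Finset.mem_univ i)

end Grid

section Brownian

/-- The increments of a process over the grid `n / N`. -/
noncomputable def gridIncr {Ω : Type*} (B : ℝ≥0 → Ω → ℝ) (N i : ℕ) (ω : Ω) : ℝ :=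
  B ((i + 1 : ℕ) / (N : ℝ≥0)) ω - B ((i : ℕ) / (N : ℝ≥0)) ω

lemma sum_gridIncr {Ω : Type*} (B : ℝ≥0 → Ω → ℝ) (N n : ℕ) (ω : Ω) :
    ∑ i ∈ Finset.range n, gridIncr B N i ω = B (n / (N : ℝ≥0)) ω - B 0 ω := by
  have h := Finset.sum_range_sub (fun i : ℕ => B ((i : ℕ) / (N : ℝ≥0)) ω) n
  simpa [gridIncr] using h

lemma abs_sub_le_runMax {Ω : Type*} (B : ℝ≥0 → Ω → ℝ) {n N : ℕ} (h : n ≤ N) (ω : Ω) :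
    |B (n / (N : ℝ≥0)) ω - B 0 ω| ≤ 1 + runMax (fun i => gridIncr B N i ω) N ^ 2
      + runMax (fun i => gridIncr (-B) N i ω) N ^ 2 := by
  have h1 := sum_le_runMax (fun i => gridIncr B N i ω) h
  have h2 := sum_le_runMax (fun i => gridIncr (-B) N i ω) h
  rw [sum_gridIncr] at h1 h2
  simp only [Pi.neg_apply] at h2
  refine abs_le.2 ⟨?_, ?_⟩ <;>
  nlinarith [sq_nonneg (runMax (fun i => gridIncr B N i ω) N - 1),
    sq_nonneg (runMax (fun i => gridIncr (-B) N i ω) N - 1),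
    sq_nonneg (runMax (fun i => gridIncr B N i ω) N),
    sq_nonneg (runMax (fun i => gridIncr (-B) N i ω) N)]

variable {Ω : Type*} [MeasurableSpace Ω] {P : Measure Ω} {B : ℝ≥0 → Ω → ℝ}

lemma iIndepFun_gridIncr (hB : IsPreBrownianReal B P) (N : ℕ) : iIndepFun (gridIncr B N) P :=
  hB.hasIndepIncrements.nat (t := fun i : ℕ => (i : ℝ≥0) / N)
    fun i j hij => by dsimp only; gcongr

lemma hasLaw_gridIncr (hB : IsPreBrownianReal B P) {N : ℕ} (hN : N ≠ 0) (i : ℕ) :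
    HasLaw (gridIncr B N i) (gaussianReal 0 (N : ℝ≥0)⁻¹) P := by
  have h := hB.hasLaw_sub ((i + 1 : ℕ) / (N : ℝ≥0)) ((i : ℕ) / (N : ℝ≥0))
  have hN' : (0 : ℝ) < N := by exact_mod_cast Nat.pos_of_ne_zero hN
  have hvar : nndist (((i + 1 : ℕ) / (N : ℝ≥0) : ℝ≥0) : ℝ) (((i : ℕ) / (N : ℝ≥0) : ℝ≥0) : ℝ)
      = (N : ℝ≥0)⁻¹ := by
    ext
    have : (((i + 1 : ℕ) / (N : ℝ≥0) : ℝ≥0) : ℝ) - (((i : ℕ) / (N : ℝ≥0) : ℝ≥0) : ℝ)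
        = (N : ℝ)⁻¹ := by
      push_cast
      field_simp
      ring
    rw [coe_nndist, Real.dist_eq, this, abs_of_pos (by positivity)]
    simp
  exact hvar ▸ h

/-- The scaled grid increments of a Brownian motion have the law of a standard normal sequence. -/
lemma identDistrib_gridIncr {Ω' : Type*} [MeasurableSpace Ω'] {P' : Measure Ω'}
    {Z : ℕ → Ω' → ℝ} (hZlaw : ∀ i, HasLaw (Z i) (gaussianReal 0 1) P') (hZ : iIndepFun Z P')
    (hB : IsPreBrownianReal B P) {N : ℕ} (hN : N ≠ 0) :
    IdentDistrib (fun ω i => Z i ω) (fun ω i => √(N : ℝ) * gridIncr B N i ω) P' P := by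
  refine IdentDistrib.pi (fun i => ?_) hZ
    ((iIndepFun_gridIncr hB N).comp (fun _ x => √(N : ℝ) * x) fun _ => by fun_prop)
  have h := gaussianReal_const_mul (hasLaw_gridIncr hB hN i) √(N : ℝ)
  refine ⟨(hZlaw i).aemeasurable, h.aemeasurable, ?_⟩
  rw [(hZlaw i).map_eq, h.map_eq, mul_zero]
  congr 1
  ext
  have hN' : (N : ℝ) ≠ 0 := by exact_mod_cast hN
  simp [hN']

lemma memLp_eval (hB : IsPreBrownianReal B P) (t : ℝ≥0) : MemLp (B t) 2 P :=
  (hB.isGaussianProcess.hasGaussianLaw_eval t).memLp_two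

lemma integral_gridIncr (hB : IsPreBrownianReal B P) (N i : ℕ) :
    ∫ ω, gridIncr B N i ω ∂P = 0 := by
  unfold gridIncr
  rw [integral_sub (hB.integrable_eval _) (hB.integrable_eval _), hB.integral_eval,
    hB.integral_eval, sub_zero]

lemma integral_runMax_gridIncr_sq_le (hB : IsPreBrownianReal B P) {N : ℕ} (hN : N ≠ 0) :
    ∫ ω, runMax (fun i => gridIncr B N i ω) N ^ 2 ∂P ≤ 4 * ∫ ω, (B 1 ω - B 0 ω) ^ 2 ∂P := by
  refine (integral_runMax_sq_le (D := gridIncr B N) (fun _ => (memLp_eval hB _).sub (memLp_eval hB _))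
    (iIndepFun_gridIncr hB N) (integral_gridIncr hB N) N).trans_eq ?_
  simp_rw [sum_gridIncr, div_self (Nat.cast_ne_zero (R := ℝ≥0).2 hN)]

lemma memLp_runMax_gridIncr (hB : IsPreBrownianReal B P) (N : ℕ) :
    MemLp (fun ω => runMax (fun i => gridIncr B N i ω) N) 2 P :=
  memLp_runMax (fun _ => (memLp_eval hB _).sub (memLp_eval hB _)) N

lemma integrable_iSup_abs (hB : IsBrownianReal B P) :
    Integrable (fun ω => ⨆ t : Set.Icc (0 : ℝ≥0) 1, |B t ω|) P := by
  have hP : IsProbabilityMeasure P := hB.isGaussianProcess.isProbabilityMeasure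
  have hB' := hB.toIsPreBrownianReal
  let G : ℕ → Ω → ℝ := fun N ω => ⨆ n : Set.Icc 0 N, |B ((n : ℕ) / (N : ℝ≥0)) ω|
  let C : ℝ := 1 + 4 * ∫ ω, (B 1 ω - B 0 ω) ^ 2 ∂P + 4 * ∫ ω, ((-B) 1 ω - (-B) 0 ω) ^ 2 ∂P
  have hGint (N : ℕ) : Integrable (G N) P :=
    integrable_iSup fun n => (hB'.integrable_eval _).abs
  have hGle {N : ℕ} (hN : N ≠ 0) : ∫⁻ ω, ‖G N ω‖ₑ ∂P ≤ ENNReal.ofReal C := by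
    have hi1 := (memLp_runMax_gridIncr hB' N).integrable_sq
    have hi2 := (memLp_runMax_gridIncr hB'.neg N).integrable_sq
    rw [← ofReal_integral_norm_eq_lintegral_enorm (hGint N)]
    refine ENNReal.ofReal_le_ofReal ?_
    calc ∫ ω, ‖G N ω‖ ∂P ≤ ∫ ω, (1 + runMax (fun i => gridIncr B N i ω) N ^ 2
          + runMax (fun i => gridIncr (-B) N i ω) N ^ 2) ∂P := by
          refine integral_mono_ae (hGint N).norm (((integrable_const 1).add hi1).add hi2) ?_
          filter_upwards [hB'.eval_zero_ae_eq_zero] with ω hω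
          refine abs_iSup_le (by positivity) fun n => ?_
          rw [abs_abs]
          simpa [hω] using abs_sub_le_runMax B n.2.2 ω
      _ = 1 + ∫ ω, runMax (fun i => gridIncr B N i ω) N ^ 2 ∂P
          + ∫ ω, runMax (fun i => gridIncr (-B) N i ω) N ^ 2 ∂P := by
          have hi : Integrable (fun ω => 1 + runMax (fun i => gridIncr B N i ω) N ^ 2) P :=
            (integrable_const 1).add hi1
          rw [integral_add hi hi2,
            integral_add (integrable_const 1) hi1]
          simp
      _ ≤ C := by
          have h1 := integral_runMax_gridIncr_sq_le hB' hN
          have h2 := integral_runMax_gridIncr_sq_le hB'.neg hN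
          simp only [C]
          linarith
  have hlim : ∀ᵐ ω ∂P, Tendsto (fun N => G N ω) atTop
      (𝓝 (⨆ t : Set.Icc (0 : ℝ≥0) 1, |B t ω|)) := by
    filter_upwards [hB.cont] with ω hω using tendsto_iSup_grid hω.abs 0
  refine ⟨aestronglyMeasurable_of_tendsto_ae atTop
    (fun N => (hGint N).aestronglyMeasurable) hlim, ?_⟩
  calc ∫⁻ ω, ‖⨆ t : Set.Icc (0 : ℝ≥0) 1, |B t ω|‖ₑ ∂P
      = ∫⁻ ω, liminf (fun N => ‖G N ω‖ₑ) atTop ∂P :=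
        lintegral_congr_ae (by filter_upwards [hlim] with ω hω using hω.enorm.liminf_eq.symm)
    _ ≤ liminf (fun N => ∫⁻ ω, ‖G N ω‖ₑ ∂P) atTop :=
        lintegral_liminf_le' fun N => (hGint N).aemeasurable.enorm
    _ ≤ ENNReal.ofReal C := liminf_le_of_frequently_le' (Eventually.frequently <| by
        filter_upwards [eventually_ne_atTop 0] with N hN using hGle hN)
    _ < ⊤ := ENNReal.ofReal_lt_top

/-- The maximum of `B t - κ √t` over the grid `n / N`, `a ≤ n ≤ N`. -/
noncomputable def gridMax (a : ℕ) (b : ℝ≥0 → ℝ) (κ : ℝ) (N : ℕ) : ℝ :=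
  ⨆ n : Set.Icc a N, (b ((n : ℕ) / (N : ℝ≥0)) - κ * √(((n : ℕ) / (N : ℝ≥0) : ℝ≥0) : ℝ))

lemma tendsto_gridMax {b : ℝ≥0 → ℝ} (hb : Continuous b) (a : ℕ) (κ : ℝ) :
    Tendsto (gridMax a b κ) atTop (𝓝 (pathSup b κ)) :=
  tendsto_iSup_grid (f := fun t => b t - κ * √(t : ℝ)) (by fun_prop) a

lemma integrable_gridMax (hB : IsPreBrownianReal B P) (a : ℕ) (κ : ℝ) (N : ℕ) :
    Integrable (fun ω => gridMax a (fun t => B t ω) κ N) P := by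
  have hP : IsProbabilityMeasure P := hB.isGaussianProcess.isProbabilityMeasure
  exact integrable_iSup fun n => (hB.integrable_eval _).sub (integrable_const _)

lemma abs_sub_mul_sqrt_le {b : ℝ≥0 → ℝ} (hb : Continuous b) (κ : ℝ) {t : ℝ≥0}
    (ht : t ∈ Set.Icc (0 : ℝ≥0) 1) :
    |b t - κ * √(t : ℝ)| ≤ (⨆ t : Set.Icc (0 : ℝ≥0) 1, |b t|) + |κ| := by
  have h1 : |b t| ≤ ⨆ t : Set.Icc (0 : ℝ≥0) 1, |b t| :=
    le_ciSup (bddAbove_range_Icc hb.abs) ⟨t, ht⟩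
  have h2 : |κ * √(t : ℝ)| ≤ |κ| := by
    rw [abs_mul, abs_of_nonneg (Real.sqrt_nonneg _)]
    exact mul_le_of_le_one_right (abs_nonneg _) (Real.sqrt_le_one.2 (by exact_mod_cast ht.2))
  exact (abs_sub _ _).trans (add_le_add h1 h2)

lemma iSup_abs_add_abs_nonneg (b : ℝ≥0 → ℝ) (κ : ℝ) :
    0 ≤ (⨆ t : Set.Icc (0 : ℝ≥0) 1, |b t|) + |κ| :=
  add_nonneg (Real.iSup_nonneg fun _ => abs_nonneg _) (abs_nonneg _)

lemma integrable_pathSup (hB : IsBrownianReal B P) (κ : ℝ) :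
    Integrable (fun ω => pathSup (fun t => B t ω) κ) P := by
  have hP : IsProbabilityMeasure P := hB.isGaussianProcess.isProbabilityMeasure
  refine ((integrable_iSup_abs hB).add (integrable_const |κ|)).mono' ?_ ?_
  · refine aestronglyMeasurable_of_tendsto_ae atTop
      (fun N => (integrable_gridMax hB.toIsPreBrownianReal 0 κ N).aestronglyMeasurable) ?_
    filter_upwards [hB.cont] with ω hω using tendsto_gridMax hω 0 κ
  · filter_upwards [hB.cont] with ω hω
    exact abs_iSup_le (iSup_abs_add_abs_nonneg (fun t => B t ω) κ) fun t => abs_sub_mul_sqrt_le hω κ t.2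

lemma tendsto_integral_gridMax (hB : IsBrownianReal B P) (a : ℕ) (κ : ℝ) :
    Tendsto (fun N => ∫ ω, gridMax a (fun t => B t ω) κ N ∂P) atTop (𝓝 (rho B P κ)) := by
  have hP : IsProbabilityMeasure P := hB.isGaussianProcess.isProbabilityMeasure
  refine tendsto_integral_of_dominated_convergence _
    (fun N => (integrable_gridMax hB.toIsPreBrownianReal a κ N).aestronglyMeasurable)
    ((integrable_iSup_abs hB).add (integrable_const |κ|)) (fun N => ?_) ?_
  · filter_upwards [hB.cont] with ω hω
    exact abs_iSup_le (iSup_abs_add_abs_nonneg (fun t => B t ω) κ)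
      fun n => abs_sub_mul_sqrt_le hω κ (natCast_div_mem_Icc n.2.2)
  · filter_upwards [hB.cont] with ω hω using tendsto_gridMax hω a κ

end Brownian

section Walk

variable {Ω : Type*} [MeasurableSpace Ω] {P : Measure Ω} {Z : ℕ → Ω → ℝ}

lemma measurable_scaledMax (a : ℕ) (κ : ℝ) (N : ℕ) :
    Measurable fun z : ℕ → ℝ => scaledMax a z κ N := by
  unfold scaledMax scaledWalk
  fun_prop

lemma integrable_scaledMax [IsFiniteMeasure P] (hZ : ∀ i, Integrable (Z i) P)
    (a : ℕ) (κ : ℝ) (N : ℕ) : Integrable (fun ω => scaledMax a (fun i => Z i ω) κ N) P :=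
  integrable_iSup fun _ => ((integrable_finsetSum _ fun i _ => hZ i).sub
    (integrable_const _)).div_const _

lemma integral_scaledMax_eq {Ω' : Type*} [MeasurableSpace Ω'] {P' : Measure Ω'}
    {B : ℝ≥0 → Ω' → ℝ} (hZlaw : ∀ i, HasLaw (Z i) (gaussianReal 0 1) P) (hZ : iIndepFun Z P)
    (hB : IsPreBrownianReal B P') (a : ℕ) (κ : ℝ) {N : ℕ} (hN : N ≠ 0) :
    ∫ ω, scaledMax a (fun i => Z i ω) κ N ∂P = ∫ ω, gridMax a (fun t => B t ω) κ N ∂P' := by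
  have h := ((identDistrib_gridIncr hZlaw hZ hB hN).comp (measurable_scaledMax a κ N)).integral_eq
  refine h.trans (integral_congr_ae ?_)
  filter_upwards [hB.eval_zero_ae_eq_zero] with ω hω
  have hN' : √(N : ℝ) ≠ 0 := by positivity
  simp only [Function.comp_apply, scaledMax, gridMax, scaledWalk, ← Finset.mul_sum, sum_gridIncr,
    hω, sub_zero]
  congr 1 with n
  push_cast
  rw [Real.sqrt_div (Nat.cast_nonneg _)]
  field_simp

lemma tendsto_integral_scaledMax {Ω' : Type*} [MeasurableSpace Ω'] {P' : Measure Ω'}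
    {B : ℝ≥0 → Ω' → ℝ} (hZlaw : ∀ i, HasLaw (Z i) (gaussianReal 0 1) P) (hZ : iIndepFun Z P)
    (hB : IsBrownianReal B P') (a : ℕ) (κ : ℝ) :
    Tendsto (fun N : ℕ => ∫ ω, scaledMax a (fun i => Z i ω) κ N ∂P) atTop
      (𝓝 (rho B P' κ)) := by
  refine (tendsto_integral_gridMax hB a κ).congr' ?_
  filter_upwards [eventually_ne_atTop 0] with N hN
  exact (integral_scaledMax_eq hZlaw hZ hB.toIsPreBrownianReal a κ hN).symm

lemma netDemand_eq (μ : ℕ → ℝ) (σ κ : ℝ) (z : ℕ → ℝ) (n : ℕ) :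
    netDemand (demand μ σ z) (supply μ σ κ) n =
      σ * ((∑ i ∈ Finset.range n, z i) - κ * √(n : ℝ)) := by
  induction n with
  | zero => simp [netDemand]
  | succ n ih =>
    rw [netDemand, Finset.sum_range_succ, ← netDemand, ih, Finset.sum_range_succ, demand, supply]
    push_cast
    ring

lemma lostSales_eq_scaledMax (μ : ℕ → ℝ) {σ : ℝ} (hσ : 0 < σ) (κ : ℝ) (z : ℕ → ℝ) (N : ℕ) :
    lostSales (demand μ σ z) (supply μ σ κ) N = σ * √(N : ℝ) * scaledMax 0 z κ N := by
  rcases eq_or_ne N 0 with rfl | hN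
  · simp [lostSales]
  have hN' : √(N : ℝ) ≠ 0 := by positivity
  have hne : Nonempty (Set.Icc 0 N) := ⟨⟨0, by simp⟩⟩
  rw [lostSales_eq_max, scaledMax, Real.mul_iSup_of_nonneg (by positivity)]
  have key (n : ℕ) : netDemand (demand μ σ z) (supply μ σ κ) n =
      σ * √(N : ℝ) * scaledWalk z κ N n := by
    rw [netDemand_eq, scaledWalk]
    field_simp
  refine le_antisymm (Finset.sup'_le _ _ fun n hn => ?_) (ciSup_le fun n => ?_)
  · rw [key]
    exact le_ciSup (f := fun n : Set.Icc 0 N => σ * √(N : ℝ) * scaledWalk z κ N n)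
      (Set.finite_range _).bddAbove ⟨n, by simp at hn ⊢; omega⟩
  · rw [← key]
    exact Finset.le_sup' _ (Finset.mem_range_succ_iff.2 n.2.2)

end Walk

end LostSales

theorem mainTheorem1
    {Ω : Type*} [MeasurableSpace Ω] (P : Measure Ω) [IsProbabilityMeasure P]
    (Z : ℕ → Ω → ℝ) (hZlaw : ∀ i, HasLaw (Z i) (gaussianReal 0 1) P) (hZindep : iIndepFun Z P)
    {Ω' : Type*} [MeasurableSpace Ω'] (P' : Measure Ω') [IsProbabilityMeasure P']
    (B : ℝ≥0 → Ω' → ℝ) (hB : IsBrownianReal B P')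
    (κ : ℝ) :
    -- all expectations are finite
    Integrable (fun ω => LostSales.pathSup (fun t => B t ω) κ) P' ∧
    (∀ N : ℕ, Integrable (fun ω => LostSales.scaledMax 0 (fun i => Z i ω) κ N) P) ∧
    (∀ N : ℕ, Integrable (fun ω => LostSales.scaledMax 1 (fun i => Z i ω) κ N) P) ∧
    -- the maximum over `0 ≤ n ≤ N` and the maximum over `1 ≤ n ≤ N`
    Tendsto (fun N : ℕ => ∫ ω, LostSales.scaledMax 0 (fun i => Z i ω) κ N ∂P)
      atTop (𝓝 (LostSales.rho B P' κ)) ∧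
    Tendsto (fun N : ℕ => ∫ ω, LostSales.scaledMax 1 (fun i => Z i ω) κ N ∂P)
      atTop (𝓝 (LostSales.rho B P' κ)) ∧
    -- the expected cumulative lost sales
    (∀ (σ : ℝ) (μ : ℕ → ℝ), 0 < σ →
      (∀ N : ℕ, Integrable (fun ω => LostSales.lostSales
        (LostSales.demand μ σ (fun i => Z i ω)) (LostSales.supply μ σ κ) N) P) ∧
      Tendsto
        (fun N : ℕ => (∫ ω, LostSales.lostSales
          (LostSales.demand μ σ (fun i => Z i ω)) (LostSales.supply μ σ κ) N ∂P)
            / (σ * √(N : ℝ)))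
        atTop (𝓝 (LostSales.rho B P' κ))) := by
  have hZint (i : ℕ) : Integrable (Z i) P := (hZlaw i).hasGaussianLaw.integrable
  refine ⟨LostSales.integrable_pathSup hB κ, LostSales.integrable_scaledMax hZint 0 κ,
    LostSales.integrable_scaledMax hZint 1 κ,
    LostSales.tendsto_integral_scaledMax hZlaw hZindep hB 0 κ,
    LostSales.tendsto_integral_scaledMax hZlaw hZindep hB 1 κ, fun σ μ hσ => ?_⟩
  simp_rw [LostSales.lostSales_eq_scaledMax μ hσ κ]
  refine ⟨fun N => (LostSales.integrable_scaledMax hZint 0 κ N).const_mul _, ?_⟩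
  refine (LostSales.tendsto_integral_scaledMax hZlaw hZindep hB 0 κ).congr' ?_
  filter_upwards [eventually_ne_atTop 0] with N hN
  have hN' : √(N : ℝ) ≠ 0 := by positivity
  rw [integral_const_mul]
  field_simp
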